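/- Let $\Sigma$ be a smooth three-manifold, let $\mathfrak{e}=(e_u,e_l,e_n)$ be a smooth global coframe on $\Sigma$, let $h_{\mathfrak{e}}=e_u\otimes e_u+e_l\otimes e_l+e_n\otimes e_n$ be the associated Riemannian metric, with Levi-Civita connection $\nabla^{\mathfrak{e}}$, and let $\Theta\in\Gamma(T^*\Sigma\odot T^*\Sigma)$ be a smooth symmetric two-tensor. For $a\in\{u,l,n\}$ let $e_a^\sharp$ be the metric dual of $e_a$ and write $\Theta(e_a)=\Theta(e_a^\sharp,\cdot)$. Let $\lambda\in\mathbb{R}\setminus\{0\}$ and suppose that $(\mathfrak{e},\Theta)$ is a Killing Cauchy pair with constant $\lambda$, that is, \[ \mathrm{d}e_u=\Theta(e_u)\wedge e_u+\lambda\, e_u\wedge e_l,\qquad \mathrm{d}e_l=\Theta(e_l)\wedge e_u,\qquad \mathrm{d}e_n=\Theta(e_n)\wedge e_u+\lambda\, e_n\wedge e_l, \] and $[\Theta(e_u)+\lambda e_l]=0\in H^1(\Sigma,\mathbb{R})$, i.e. $\Theta(e_u)+\lambda e_l$ is the differential of a smooth function on $\Sigma$. Then the Hamiltonian constraint with cosmological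 constant $\Lambda=-3\lambda^2$, \[ \mathrm{R}_{h_{\mathfrak{e}}}=|\Theta|^2_{h_{\mathfrak{e}}}-\mathrm{Tr}_{h_{\mathfrak{e}}}(\Theta)^2-6\lambda^2\quad\text{on }\Sigma, \] where $\mathrm{R}_{h_{\mathfrak{e}}}$ is the scalar curvature, holds if and only if the momentum constraint \[ \mathrm{d}\,\mathrm{Tr}_{h_{\mathfrak{e}}}(\Theta)=\mathrm{div}_{h_{\mathfrak{e}}}(\Theta)\quad\text{on }\Sigma \] holds, where $\mathrm{div}_{h_{\mathfrak{e}}}(\Theta)(X)=\sum_{a}(\nabla^{\mathfrak{e}}_{e_a^\sharp}\Theta)(e_a^\sharp,X)$. -/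

import Mathlib

open Bundle VectorField
open scoped Manifold ContDiff

noncomputable section

namespace KillingCauchy

/-- The model space of three-manifolds. -/
abbrev E3 : Type := EuclideanSpace ℝ (Fin 3)

variable (M : Type*) [TopologicalSpace M] [ChartedSpace E3 M] [IsManifold (𝓡 3) ∞ M]

/-- (Not necessarily smooth) vector fields. -/
abbrev VField : Type _ := (p : M) → TangentSpace (𝓡 3) p

/-- (Not necessarily smooth) one-forms. -/
abbrev OneForm : Type _ := (p : M) → TangentSpace (𝓡 3) p →L[ℝ] ℝ

/-- (Not necessarily smooth) fields of bilinear forms on the tangent spaces. -/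
abbrev BilinField : Type _ :=
  (p : M) → TangentSpace (𝓡 3) p →L[ℝ] TangentSpace (𝓡 3) p →L[ℝ] ℝ

variable {M}

/-- Smooth vector fields: smooth sections of the tangent bundle. -/
def VField.IsSmooth (X : VField M) : Prop :=
  ContMDiff (𝓡 3) ((𝓡 3).prod 𝓘(ℝ, E3)) ∞
    (fun p => TotalSpace.mk' E3 (E := fun q : M => TangentSpace (𝓡 3) q) p (X p))

/-- Smooth one-forms: smooth sections of the cotangent bundle. -/
def OneForm.IsSmooth (α : OneForm M) : Prop :=
  ContMDiff (𝓡 3) ((𝓡 3).prod 𝓘(ℝ, E3 →L[ℝ] ℝ)) ∞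
    (fun p => TotalSpace.mk' (E3 →L[ℝ] ℝ)
      (E := fun q : M => TangentSpace (𝓡 3) q →L[ℝ] Trivial M ℝ q) p (α p))

/-- Smooth fields of bilinear forms: smooth sections of `T*M ⊗ T*M`. -/
def BilinField.IsSmooth (Θ : BilinField M) : Prop :=
  ContMDiff (𝓡 3) ((𝓡 3).prod 𝓘(ℝ, E3 →L[ℝ] E3 →L[ℝ] ℝ)) ∞
    (fun p => TotalSpace.mk' (E3 →L[ℝ] E3 →L[ℝ] ℝ)
      (E := fun q : M => TangentSpace (𝓡 3) q →L[ℝ] TangentSpace (𝓡 3) q →L[ℝ] Trivial M ℝ q)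
      p (Θ p))

variable (M) in
/-- A smooth symmetric two-tensor `Θ ∈ Γ(T*M ⊙ T*M)`. -/
structure SymTensor where
  toFun : BilinField M
  smooth : toFun.IsSmooth
  symm : ∀ (p : M) (v w : TangentSpace (𝓡 3) p), toFun p v w = toFun p w v

variable (M) in
/-- A smooth global coframe `(e_u, e_l, e_n)`; the indices `0, 1, 2` stand for `u, l, n`. -/
structure Coframe where
  form : Fin 3 → OneForm M
  smooth : ∀ a, (form a).IsSmooth
  linearIndependent : ∀ p : M, LinearIndependent ℝ (fun a => form a p)

/-- The one-form `e_u`. -/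
abbrev Coframe.u (e : Coframe M) : OneForm M := e.form 0
/-- The one-form `e_l`. -/
abbrev Coframe.l (e : Coframe M) : OneForm M := e.form 1
/-- The one-form `e_n`. -/
abbrev Coframe.n (e : Coframe M) : OneForm M := e.form 2

/-- The derivative `X(f)` of a function along a vector field. -/
def dirDeriv (X : VField M) (f : M → ℝ) : M → ℝ :=
  fun p => mvfderiv (𝓡 3) f p (X p)

/-- The exterior derivative of a one-form:
`dα(X, Y) = X(α(Y)) - Y(α(X)) - α([X, Y])`. -/
def extDeriv1 (α : OneForm M) (X Y : VField M) : M → ℝ := fun p =>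
  dirDeriv X (fun q => α q (Y q)) p - dirDeriv Y (fun q => α q (X q)) p
    - α p (mlieBracket (𝓡 3) X Y p)

/-- The wedge product of one-forms: `(α ∧ β)(X, Y) = α(X) β(Y) - α(Y) β(X)`. -/
def wedge (α β : OneForm M) (X Y : VField M) : M → ℝ := fun p =>
  α p (X p) * β p (Y p) - α p (Y p) * β p (X p)

/-- `α` vanishes in `H¹(M, ℝ)`: it is the differential of a smooth function. -/
def IsExact (α : OneForm M) : Prop :=
  ∃ f : M → ℝ, ContMDiff (𝓡 3) 𝓘(ℝ, ℝ) ∞ f ∧ ∀ p, α p = mvfderiv (𝓡 3) f p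

namespace Coframe

variable (e : Coframe M)

theorem bijective (p : M) :
    Function.Bijective (LinearMap.pi (fun a => (e.form a p : TangentSpace (𝓡 3) p →ₗ[ℝ] ℝ))) := by
  have hfd : FiniteDimensional ℝ (TangentSpace (𝓡 3) p) :=
    inferInstanceAs (FiniteDimensional ℝ E3)
  have hdim : Module.finrank ℝ (TangentSpace (𝓡 3) p) = 3 :=
    (finrank_euclideanSpace_fin : Module.finrank ℝ E3 = 3)
  have hli : LinearIndependent ℝ
      (fun a => ((e.form a p : TangentSpace (𝓡 3) p →ₗ[ℝ] ℝ) :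
        Module.Dual ℝ (TangentSpace (𝓡 3) p))) :=
    (e.linearIndependent p).map' (ContinuousLinearMap.coeLM ℝ)
      (LinearMap.ker_eq_bot.2 ContinuousLinearMap.coe_injective)
  have hspan := hli.span_eq_top_of_card_eq_finrank' (by
    rw [Subspace.dual_finrank_eq, hdim]; simp)
  have hinj : Function.Injective
      (LinearMap.pi (fun a => (e.form a p : TangentSpace (𝓡 3) p →ₗ[ℝ] ℝ))) := by
    rw [← LinearMap.ker_eq_bot, LinearMap.ker_eq_bot']
    intro v hv
    refine (Module.forall_dual_apply_eq_zero_iff ℝ v).1 fun φ => ?_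
    have hφ : φ ∈ Submodule.span ℝ (Set.range
      (fun a => ((e.form a p : TangentSpace (𝓡 3) p →ₗ[ℝ] ℝ) :
        Module.Dual ℝ (TangentSpace (𝓡 3) p)))) := by rw [hspan]; trivial
    induction hφ using Submodule.span_induction with
    | mem x hx => obtain ⟨a, rfl⟩ := hx; exact congrFun hv a
    | zero => rfl
    | add x y _ _ hx hy => rw [LinearMap.add_apply, hx, hy, add_zero]
    | smul c x _ hx => rw [LinearMap.smul_apply, hx, smul_zero]
  exact ⟨hinj, (LinearMap.injective_iff_surjective_of_finrank_eq_finrank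
    (by rw [hdim]; simp)).1 hinj⟩

/-- The frame dual to `e`, i.e. `e_a(E_b) = δ_ab`. As `e` is orthonormal for `h_e`, the vector
field `E_a` is the metric dual `e_a^♯`. -/
def frame (a : Fin 3) : VField M := fun p =>
  (LinearEquiv.ofBijective _ (e.bijective p)).symm (Pi.single a 1)

theorem form_frame (a b : Fin 3) (p : M) :
    e.form a p (e.frame b p) = if a = b then 1 else 0 := by
  have := congrFun ((LinearEquiv.ofBijective _ (e.bijective p)).apply_symm_apply
    (Pi.single b 1)) a
  exact this.trans (Pi.single_apply b 1 a)

/-- The Riemannian metric `h_e = e_u ⊗ e_u + e_l ⊗ e_l + e_n ⊗ e_n`. -/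
def metric : BilinField M := fun p => ∑ a, (e.form a p).smulRight (e.form a p)

/-- The right-hand side of the Koszul formula for the metric `h_e`:
`2 h(∇_X Y, Z) = X h(Y, Z) + Y h(Z, X) - Z h(X, Y) + h([X, Y], Z) - h([Y, Z], X) + h([Z, X], Y)`. -/
def koszul (X Y Z : VField M) : M → ℝ := fun p =>
  dirDeriv X (fun q => e.metric q (Y q) (Z q)) p
    + dirDeriv Y (fun q => e.metric q (Z q) (X q)) p
    - dirDeriv Z (fun q => e.metric q (X q) (Y q)) p
    + e.metric p (mlieBracket (𝓡 3) X Y p) (Z p)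
    - e.metric p (mlieBracket (𝓡 3) Y Z p) (X p)
    + e.metric p (mlieBracket (𝓡 3) Z X p) (Y p)

/-- The Levi-Civita connection `∇_X Y` of `h_e`, given by the Koszul formula: the component of
`∇_X Y` along the `h_e`-orthonormal frame field `E_c` is `h(∇_X Y, E_c)`. -/
def nabla (X Y : VField M) : VField M := fun p =>
  ∑ c, (e.koszul X Y (e.frame c) p / 2) • e.frame c p

/-- The curvature `R(X, Y) Z = ∇_X ∇_Y Z - ∇_Y ∇_X Z - ∇_[X, Y] Z` of `h_e`. -/
def riemann (X Y Z : VField M) : VField M := fun p =>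
  e.nabla X (e.nabla Y Z) p - e.nabla Y (e.nabla X Z) p
    - e.nabla (fun q => mlieBracket (𝓡 3) X Y q) Z p

/-- The Ricci curvature of `h_e`: `Ric(Y, Z)` is the trace of `X ↦ R(X, Y) Z`. -/
def ricci (Y Z : VField M) : M → ℝ := fun p =>
  ∑ a, e.metric p (e.riemann (e.frame a) Y Z p) (e.frame a p)

/-- The scalar curvature of `h_e`: the `h_e`-trace of the Ricci curvature. -/
def scal : M → ℝ := fun p => ∑ a, e.ricci (e.frame a) (e.frame a) p

/-- The `h_e`-trace of `Θ`. -/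
def tr (Θ : SymTensor M) : M → ℝ := fun p =>
  ∑ a, Θ.toFun p (e.frame a p) (e.frame a p)

/-- The squared norm `|Θ|²` with respect to `h_e`. -/
def normSq (Θ : SymTensor M) : M → ℝ := fun p =>
  ∑ a, ∑ b, (Θ.toFun p (e.frame a p) (e.frame b p)) ^ 2

/-- The covariant derivative `(∇_X Θ)(Y, Z) = X(Θ(Y, Z)) - Θ(∇_X Y, Z) - Θ(Y, ∇_X Z)`. -/
def nablaTensor (Θ : SymTensor M) (X Y Z : VField M) : M → ℝ := fun p =>
  dirDeriv X (fun q => Θ.toFun q (Y q) (Z q)) p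
    - Θ.toFun p (e.nabla X Y p) (Z p) - Θ.toFun p (Y p) (e.nabla X Z p)

/-- The divergence `div(Θ)(X) = ∑_a (∇_{E_a} Θ)(E_a, X)` with respect to `h_e`. -/
def div (Θ : SymTensor M) (X : VField M) : M → ℝ := fun p =>
  ∑ a, e.nablaTensor Θ (e.frame a) (e.frame a) X p

/-- The one-form `Θ(e_a) = Θ(e_a^♯, ·)`. -/
def contract (Θ : SymTensor M) (a : Fin 3) : OneForm M := fun p =>
  Θ.toFun p (e.frame a p)

end Coframe

/-- `(e, Θ)` is a Killing Cauchy pair with Killing constant `lam`. -/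
structure IsKillingCauchyPair (lam : ℝ) (e : Coframe M) (Θ : SymTensor M) : Prop where
  ne_zero : lam ≠ 0
  d_u : ∀ X Y : VField M, X.IsSmooth → Y.IsSmooth → ∀ p,
    extDeriv1 e.u X Y p = wedge (e.contract Θ 0) e.u X Y p + lam * wedge e.u e.l X Y p
  d_l : ∀ X Y : VField M, X.IsSmooth → Y.IsSmooth → ∀ p,
    extDeriv1 e.l X Y p = wedge (e.contract Θ 1) e.u X Y p
  d_n : ∀ X Y : VField M, X.IsSmooth → Y.IsSmooth → ∀ p,
    extDeriv1 e.n X Y p = wedge (e.contract Θ 2) e.u X Y p + lam * wedge e.n e.l X Y p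
  exact : IsExact (fun p => e.contract Θ 0 p + lam • e.l p)

/-- The Hamiltonian constraint `R_h = |Θ|²_h - Tr_h(Θ)² + 2 Λ` for `h = h_e`, with
cosmological constant `Λ`. -/
def HamiltonianConstraint (Lam : ℝ) (e : Coframe M) (Θ : SymTensor M) : Prop :=
  ∀ p, e.scal p = e.normSq Θ p - (e.tr Θ p) ^ 2 + 2 * Lam

/-- The momentum constraint `d Tr_h(Θ) = div_h(Θ)` for `h = h_e`. -/
def MomentumConstraint (e : Coframe M) (Θ : SymTensor M) : Prop :=
  ∀ X : VField M, X.IsSmooth → ∀ p, dirDeriv X (e.tr Θ) p = e.div Θ X p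

end KillingCauchy

end

/-!
In the orthonormal frame dual to `e`, the structure equations and the Koszul formula give the
Levi-Civita connection forms `A_bk = δ_ku Θ(e_b) - δ_bu Θ(e_k) + λ (δ_kl e_b - δ_bl e_k)`. Let
`C(X, Y; Z) = (∇_X Θ)(Y, Z) - (∇_Y Θ)(X, Z)`. The curvature of `A` has the Gauss-Codazzi shape
`e_k(R(X, Y) E_b) = δ_ku C(X, Y; E_b) - δ_bu C(X, Y; E_k) + (Θ(e_b) ∧ Θ(e_k) + λ² e_b ∧ e_k)(X, Y)`.

Closedness of `Θ(e_u) + λ e_l` means `C(·, ·; E_u) = 0`, and the Bianchi identity for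
`(E_u, E_l, E_n)` means `C(E_l, E_n; ·) = 0`. Hence the momentum defect
`d Tr Θ - div Θ = ∑ a, C(·, E_a; E_a)` vanishes on `E_l` and `E_n`. Tracing the curvature shows that
the Hamiltonian defect is `2 ∑ a, C(E_u, E_a; E_a)`, twice the momentum defect on `E_u`, so that
`2 (d Tr Θ - div Θ) = (R - |Θ|² + Tr(Θ)² + 6 λ²) e_u` and the two constraints are equivalent.
-/

noncomputable section

namespace KillingCauchy

variable {M : Type*} [TopologicalSpace M] [ChartedSpace E3 M]

/-- Smooth real-valued functions. -/
abbrev IsSmoothFun (f : M → ℝ) : Prop := ContMDiff (𝓡 3) 𝓘(ℝ, ℝ) ∞ f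

theorem IsSmoothFun.mdifferentiableAt {f : M → ℝ} (hf : IsSmoothFun f) (p : M) :
    MDifferentiableAt (𝓡 3) 𝓘(ℝ, ℝ) f p :=
  ContMDiff.mdifferentiable hf (by simp) p

section DirDeriv

variable {f g : M → ℝ} {p : M} (X : VField M)

theorem dirDeriv_const (c : ℝ) (p : M) : dirDeriv X (fun _ => c) p = 0 := by
  simp [dirDeriv, mvfderiv_const]

theorem dirDeriv_add (hf : MDifferentiableAt (𝓡 3) 𝓘(ℝ, ℝ) f p)
    (hg : MDifferentiableAt (𝓡 3) 𝓘(ℝ, ℝ) g p) :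
    dirDeriv X (fun q => f q + g q) p = dirDeriv X f p + dirDeriv X g p := by
  simp [dirDeriv, mvfderiv_fun_add hf hg]

theorem dirDeriv_mul (hf : MDifferentiableAt (𝓡 3) 𝓘(ℝ, ℝ) f p)
    (hg : MDifferentiableAt (𝓡 3) 𝓘(ℝ, ℝ) g p) :
    dirDeriv X (fun q => f q * g q) p = f p * dirDeriv X g p + g p * dirDeriv X f p := by
  simp [dirDeriv, mvfderiv_fun_mul hf hg]

theorem dirDeriv_sum {ι : Type} {s : Finset ι} {f : ι → M → ℝ}
    (hf : ∀ i ∈ s, MDifferentiableAt (𝓡 3) 𝓘(ℝ, ℝ) (f i) p) :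
    dirDeriv X (fun q => ∑ i ∈ s, f i q) p = ∑ i ∈ s, dirDeriv X (f i) p := by
  classical
  induction s using Finset.induction_on with
  | empty => simpa using dirDeriv_const X 0 p
  | insert i s hi ih =>
    rw [Finset.forall_mem_insert] at hf
    have hsum : MDifferentiableAt (𝓡 3) 𝓘(ℝ, ℝ) (fun q => ∑ j ∈ s, f j q) p := by
      simpa only [← Finset.sum_apply] using! MDifferentiableAt.sum hf.2
    simp only [Finset.sum_insert hi]
    rw [dirDeriv_add X hf.1 hsum, ih hf.2]

end DirDeriv

theorem extDeriv1_swap (α : OneForm M) (X Y : VField M) (p : M) :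
    extDeriv1 α X Y p = -extDeriv1 α Y X p := by
  rw [extDeriv1, mlieBracket_swap_apply, map_neg, extDeriv1]
  ring

variable [IsManifold (𝓡 3) ∞ M]

theorem IsSmoothFun.dirDeriv {f : M → ℝ} (hf : IsSmoothFun f) {X : VField M} (hX : X.IsSmooth) :
    IsSmoothFun (dirDeriv X f) :=
  (contMDiff_snd_tangentBundle_modelSpace ℝ 𝓘(ℝ, ℝ)).comp
    ((ContMDiff.contMDiff_tangentMap hf (by simp)).comp hX)

theorem OneForm.IsSmooth.apply {α : OneForm M} (hα : α.IsSmooth) {X : VField M}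
    (hX : X.IsSmooth) : IsSmoothFun (fun p => α p (X p)) := fun p =>
  (Bundle.contMDiffAt_section p).1
    (ContMDiff.clm_bundle_apply (b := fun q : M => q) (E₁ := fun q : M => TangentSpace (𝓡 3) q)
      (E₂ := Trivial M ℝ) hα hX p)

theorem BilinField.IsSmooth.apply {Θ : BilinField M} (hΘ : Θ.IsSmooth) {X Y : VField M}
    (hX : X.IsSmooth) (hY : Y.IsSmooth) : IsSmoothFun (fun p => Θ p (X p) (Y p)) := fun p =>
  (Bundle.contMDiffAt_section p).1
    (ContMDiff.clm_bundle_apply₂ (b := fun q : M => q) (E₁ := fun q : M => TangentSpace (𝓡 3) q)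
      (E₂ := fun q : M => TangentSpace (𝓡 3) q) (E₃ := Trivial M ℝ) hΘ hX hY p)

section LieBracket

variable {X Y Z : VField M}

theorem VField.IsSmooth.mdifferentiableAt (hX : X.IsSmooth) (p : M) :
    MDifferentiableAt (𝓡 3) ((𝓡 3).prod 𝓘(ℝ, E3))
      (fun q => TotalSpace.mk' E3 (E := fun q : M => TangentSpace (𝓡 3) q) q (X q)) p :=
  ContMDiff.mdifferentiable hX (by simp) p

theorem VField.IsSmooth.mlieBracket (hX : X.IsSmooth) (hY : Y.IsSmooth) :
    VField.IsSmooth (mlieBracket (𝓡 3) X Y) :=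
  have : IsManifold (𝓡 3) (((⊤ : ℕ∞) : WithTop ℕ∞) + 1) M := ‹IsManifold (𝓡 3) ∞ M›
  have : IsManifold (𝓡 3) (minSmoothness ℝ 2) M :=
    IsManifold.of_le (n := ∞) (by simpa using ENat.LEInfty.out)
  ContDiff.mlieBracket_vectorField (m := ⊤) (n := ⊤) hX hY (by simp)

theorem mlieBracket_jacobi (hX : X.IsSmooth) (hY : Y.IsSmooth) (hZ : Z.IsSmooth) (p : M) :
    mlieBracket (𝓡 3) X (mlieBracket (𝓡 3) Y Z) p =
      mlieBracket (𝓡 3) (mlieBracket (𝓡 3) X Y) Z p +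
        mlieBracket (𝓡 3) Y (mlieBracket (𝓡 3) X Z) p := by
  have : IsManifold (𝓡 3) (minSmoothness ℝ 3) M :=
    IsManifold.of_le (n := ∞) (by simpa using ENat.LEInfty.out)
  have h2 : minSmoothness ℝ 2 ≤ (∞ : WithTop ℕ∞) := by simpa using ENat.LEInfty.out
  exact leibniz_identity_mlieBracket_apply ((hX p).of_le h2) ((hY p).of_le h2) ((hZ p).of_le h2)

theorem mlieBracket_cyclic (hX : X.IsSmooth) (hY : Y.IsSmooth) (hZ : Z.IsSmooth) (p : M) :
    mlieBracket (𝓡 3) X (mlieBracket (𝓡 3) Y Z) p +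
      mlieBracket (𝓡 3) Y (mlieBracket (𝓡 3) Z X) p +
        mlieBracket (𝓡 3) Z (mlieBracket (𝓡 3) X Y) p = 0 := by
  have hXYZ : mlieBracket (𝓡 3) (mlieBracket (𝓡 3) X Y) Z p =
      -mlieBracket (𝓡 3) Z (mlieBracket (𝓡 3) X Y) p := mlieBracket_swap_apply
  have hYXZ : mlieBracket (𝓡 3) Y (mlieBracket (𝓡 3) X Z) p =
      -mlieBracket (𝓡 3) Y (mlieBracket (𝓡 3) Z X) p := by
    rw [mlieBracket_swap (V := X), ← neg_one_smul ℝ, mlieBracket_const_smul_right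
      ((hZ.mlieBracket hX).mdifferentiableAt p), neg_one_smul]
  rw [mlieBracket_jacobi hX hY hZ, hXYZ, hYXZ]
  abel

variable {f : M → ℝ}

theorem mlieBracket_smul_eq_dirDeriv (X : VField M) (hf : IsSmoothFun f) (hZ : Z.IsSmooth) (p : M) :
    mlieBracket (𝓡 3) X (f • Z) p = dirDeriv X f p • Z p + f p • mlieBracket (𝓡 3) X Z p :=
  mlieBracket_smul_right (hf.mdifferentiableAt p) (hZ.mdifferentiableAt p)

theorem mlieBracket_mlieBracket_smul (X : VField M) (hY : Y.IsSmooth)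
    (hf : IsSmoothFun f) (hZ : Z.IsSmooth) (p : M) :
    mlieBracket (𝓡 3) X (mlieBracket (𝓡 3) Y (f • Z)) p =
      dirDeriv X (dirDeriv Y f) p • Z p + dirDeriv Y f p • mlieBracket (𝓡 3) X Z p +
        (dirDeriv X f p • mlieBracket (𝓡 3) Y Z p +
          f p • mlieBracket (𝓡 3) X (mlieBracket (𝓡 3) Y Z) p) := by
  have hsplit : mlieBracket (𝓡 3) Y (f • Z) = dirDeriv Y f • Z + f • mlieBracket (𝓡 3) Y Z :=
    funext fun q => mlieBracket_smul_eq_dirDeriv Y hf hZ q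
  have hYf := hf.dirDeriv hY
  have hYZ := hY.mlieBracket hZ
  have hleft : VField.IsSmooth (dirDeriv Y f • Z) := ContMDiff.smul_section hYf hZ
  have hright : VField.IsSmooth (f • mlieBracket (𝓡 3) Y Z) := ContMDiff.smul_section hf hYZ
  rw [hsplit, mlieBracket_add_right (hleft.mdifferentiableAt p) (hright.mdifferentiableAt p),
    mlieBracket_smul_eq_dirDeriv X hYf hZ, mlieBracket_smul_eq_dirDeriv X hf hYZ]

/- Mathlib knows the action of the bracket on functions only through the Leibniz rule, so the
identity is read off as the `Z`-component of the Jacobi identity for `X`, `Y`, `f Z`. -/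
theorem dirDeriv_mlieBracket (hX : X.IsSmooth) (hY : Y.IsSmooth) (hf : IsSmoothFun f)
    (hZ : Z.IsSmooth) {p : M} (hp : Z p ≠ 0) :
    dirDeriv (mlieBracket (𝓡 3) X Y) f p =
      dirDeriv X (dirDeriv Y f) p - dirDeriv Y (dirDeriv X f) p := by
  have hjacobi := mlieBracket_jacobi hX hY (ContMDiff.smul_section hf hZ : (f • Z).IsSmooth) p
  rw [mlieBracket_mlieBracket_smul X hY hf hZ, mlieBracket_mlieBracket_smul Y hX hf hZ,
    mlieBracket_smul_eq_dirDeriv _ hf hZ, mlieBracket_jacobi hX hY hZ, ← sub_eq_zero] at hjacobi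
  rw [← sub_eq_zero]
  refine (smul_eq_zero.1 ?_).resolve_right hp
  rw [← neg_eq_zero, ← hjacobi]
  module

end LieBracket

section ExteriorDerivative

variable {α β : OneForm M} {X Y : VField M}

theorem OneForm.IsSmooth.extDeriv1 (hα : α.IsSmooth) (hX : X.IsSmooth) (hY : Y.IsSmooth) :
    IsSmoothFun (extDeriv1 α X Y) :=
  (((hα.apply hY).dirDeriv hX).sub ((hα.apply hX).dirDeriv hY)).sub (hα.apply (hX.mlieBracket hY))

theorem OneForm.IsSmooth.add (hα : α.IsSmooth) (hβ : β.IsSmooth) : (α + β).IsSmooth :=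
  ContMDiff.add_section hα hβ

theorem OneForm.IsSmooth.sub (hα : α.IsSmooth) (hβ : β.IsSmooth) : (α - β).IsSmooth :=
  ContMDiff.sub_section hα hβ

theorem OneForm.IsSmooth.smul (c : ℝ) (hα : α.IsSmooth) : (c • α).IsSmooth :=
  ContMDiff.const_smul_section hα

theorem extDeriv1_add (hα : α.IsSmooth) (hβ : β.IsSmooth) (hX : X.IsSmooth) (hY : Y.IsSmooth)
    (p : M) : extDeriv1 (α + β) X Y p = extDeriv1 α X Y p + extDeriv1 β X Y p := by
  have happly := fun {γ : OneForm M} {Z : VField M} (hγ : γ.IsSmooth) (hZ : Z.IsSmooth) =>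
    (hγ.apply hZ).mdifferentiableAt p
  simp only [extDeriv1, Pi.add_apply, add_apply]
  rw [dirDeriv_add _ (happly hα hY) (happly hβ hY), dirDeriv_add _ (happly hα hX) (happly hβ hX)]
  ring

theorem extDeriv1_smul (c : ℝ) (hα : α.IsSmooth) (hX : X.IsSmooth) (hY : Y.IsSmooth) (p : M) :
    extDeriv1 (c • α) X Y p = c * extDeriv1 α X Y p := by
  have happly := fun {Z : VField M} (hZ : Z.IsSmooth) => (hα.apply hZ).mdifferentiableAt p
  simp only [extDeriv1, Pi.smul_apply, smul_apply, smul_eq_mul]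
  rw [dirDeriv_mul _ mdifferentiableAt_const (happly hY),
    dirDeriv_mul _ mdifferentiableAt_const (happly hX), dirDeriv_const, dirDeriv_const]
  ring

theorem extDeriv1_sub (hα : α.IsSmooth) (hβ : β.IsSmooth) (hX : X.IsSmooth) (hY : Y.IsSmooth)
    (p : M) : extDeriv1 (α - β) X Y p = extDeriv1 α X Y p - extDeriv1 β X Y p := by
  have hsub : α - β = α + (-1 : ℝ) • β := by module
  rw [hsub, extDeriv1_add hα (hβ.smul _) hX hY, extDeriv1_smul _ hβ hX hY, neg_one_mul,
    sub_eq_add_neg]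

end ExteriorDerivative

namespace Coframe

variable (e : Coframe M)

section Frame

theorem ext_form {p : M} {v w : TangentSpace (𝓡 3) p} (h : ∀ a, e.form a p v = e.form a p w) :
    v = w :=
  (e.bijective p).1 (funext h)

theorem frame_ne_zero (a : Fin 3) (p : M) : e.frame a p ≠ 0 := fun h => by
  simpa [h] using e.form_frame a a p

theorem sum_form_smul_frame (p : M) (v : TangentSpace (𝓡 3) p) :
    ∑ a, e.form a p v • e.frame a p = v :=
  e.ext_form fun a => by simp [form_frame]

theorem metric_apply (p : M) (v w : TangentSpace (𝓡 3) p) :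
    e.metric p v w = ∑ a, e.form a p v * e.form a p w := by
  simp [metric]

theorem metric_frame_right (p : M) (v : TangentSpace (𝓡 3) p) (a : Fin 3) :
    e.metric p v (e.frame a p) = e.form a p v := by
  simp [metric_apply, form_frame]

/-- The coframe at `q` as a linear map `E3 → ℝ³`, read in the trivialization of the tangent bundle
at `p₀`. -/
def formsInCoordinates (p₀ q : M) : E3 →L[ℝ] (Fin 3 → ℝ) :=
  ContinuousLinearMap.pi fun a =>
    ContinuousLinearMap.inCoordinates E3 (fun q : M => TangentSpace (𝓡 3) q) ℝ (Trivial M ℝ)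
      p₀ q p₀ q (e.form a q)

theorem contMDiffAt_formsInCoordinates (p₀ : M) :
    ContMDiffAt (𝓡 3) 𝓘(ℝ, E3 →L[ℝ] (Fin 3 → ℝ)) ∞ (e.formsInCoordinates p₀) p₀ := by
  have hform : ContMDiffAt (𝓡 3) 𝓘(ℝ, Fin 3 → E3 →L[ℝ] ℝ) ∞
      (fun q a => ContinuousLinearMap.inCoordinates E3 (fun q : M => TangentSpace (𝓡 3) q) ℝ
        (Trivial M ℝ) p₀ q p₀ q (e.form a q)) p₀ :=
    contMDiffAt_pi_space.2 fun a => ((contMDiffAt_hom_bundle _).1 (e.smooth a p₀)).2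
  have hpi := (ContinuousLinearMap.piEquivL ℝ E3 fun _ : Fin 3 => ℝ).contDiff (n := ∞)
  exact hpi.contMDiff.contMDiffAt.comp p₀ hform

theorem formsInCoordinates_eq {p₀ q : M}
    (hq : q ∈ (trivializationAt E3 (fun q : M => TangentSpace (𝓡 3) q) p₀).baseSet) :
    e.formsInCoordinates p₀ q =
      ((((trivializationAt E3 (fun q : M => TangentSpace (𝓡 3) q) p₀).continuousLinearEquivAt
        ℝ q hq).symm.toLinearEquiv.trans
        (LinearEquiv.ofBijective _ (e.bijective q))).toContinuousLinearEquiv :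
        E3 →L[ℝ] (Fin 3 → ℝ)) := by
  ext v a
  simp only [formsInCoordinates, ContinuousLinearMap.coe_pi']
  rw [ContinuousLinearMap.inCoordinates_eq hq (by simp)]
  simp

theorem isSmooth_of_form {X : VField M} (hX : ∀ a, IsSmoothFun (fun p => e.form a p (X p))) :
    X.IsSmooth := by
  intro p₀
  have hp₀ := FiberBundle.mem_baseSet_trivializationAt' (F := E3)
    (E := fun q : M => TangentSpace (𝓡 3) q) p₀
  have hinverse : ContMDiffAt (𝓡 3) 𝓘(ℝ, (Fin 3 → ℝ) →L[ℝ] E3) ∞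
      (fun q => (e.formsInCoordinates p₀ q).inverse) p₀ := by
    refine ContMDiffAt.comp p₀ (g := ContinuousLinearMap.inverse) ?_
      (e.contMDiffAt_formsInCoordinates p₀)
    rw [e.formsInCoordinates_eq hp₀]
    exact (contDiffAt_map_inverse _).contMDiffAt
  have hcomponents : ContMDiffAt (𝓡 3) 𝓘(ℝ, Fin 3 → ℝ) ∞ (fun q a => e.form a q (X q)) p₀ :=
    contMDiffAt_pi_space.2 fun a => hX a p₀
  rw [contMDiffAt_totalSpace]
  refine ⟨contMDiffAt_id, (hinverse.clm_apply hcomponents).congr_of_eventuallyEq ?_⟩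
  filter_upwards [(trivializationAt E3 (fun q : M => TangentSpace (𝓡 3) q) p₀).open_baseSet.mem_nhds
    hp₀] with q hq
  rw [e.formsInCoordinates_eq hq, ContinuousLinearMap.inverse_equiv]
  change _ = ((trivializationAt E3 (fun q : M => TangentSpace (𝓡 3) q) p₀).continuousLinearEquivAt
    ℝ q hq) ((LinearEquiv.ofBijective _ (e.bijective q)).symm fun a => e.form a q (X q))
  have hX : ((LinearEquiv.ofBijective _ (e.bijective q)).symm fun a => e.form a q (X q)) = X q :=
    (LinearEquiv.ofBijective _ (e.bijective q)).symm_apply_apply (X q)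
  rw [hX]
  rfl

theorem frame_smooth (b : Fin 3) : (e.frame b).IsSmooth :=
  e.isSmooth_of_form fun a => by simpa only [form_frame] using contMDiff_const

end Frame

section LeviCivita

variable {X Y Y' Z : VField M}

theorem metric_comm (p : M) (v w : TangentSpace (𝓡 3) p) : e.metric p v w = e.metric p w v := by
  simp only [metric_apply, mul_comm]

theorem form_nabla (k : Fin 3) (X Y : VField M) (p : M) :
    e.form k p (e.nabla X Y p) = e.koszul X Y (e.frame k) p / 2 := by
  simp [nabla, form_frame]

theorem koszul_frame (X Y : VField M) (k : Fin 3) (p : M) :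
    e.koszul X Y (e.frame k) p =
      dirDeriv X (fun q => e.form k q (Y q)) p + dirDeriv Y (fun q => e.form k q (X q)) p
        - dirDeriv (e.frame k) (fun q => e.metric q (X q) (Y q)) p
        + e.form k p (mlieBracket (𝓡 3) X Y p)
        - e.metric p (mlieBracket (𝓡 3) Y (e.frame k) p) (X p)
        - e.metric p (mlieBracket (𝓡 3) X (e.frame k) p) (Y p) := by
  have hleft : (fun q => e.metric q (e.frame k q) (X q)) = fun q => e.form k q (X q) :=
    funext fun q => by rw [metric_comm, metric_frame_right]
  have hswap : mlieBracket (𝓡 3) (e.frame k) X p = -mlieBracket (𝓡 3) X (e.frame k) p :=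
    mlieBracket_swap_apply
  rw [koszul, hleft, hswap, map_neg, neg_apply]
  simp only [metric_frame_right, sub_eq_add_neg]

theorem nabla_sub_nabla_swap (X Y : VField M) (p : M) :
    e.nabla X Y p - e.nabla Y X p = mlieBracket (𝓡 3) X Y p := by
  refine e.ext_form fun k => ?_
  have hcomm : (fun q => e.metric q (Y q) (X q)) = fun q => e.metric q (X q) (Y q) :=
    funext fun q => e.metric_comm q _ _
  have hswap : mlieBracket (𝓡 3) Y X p = -mlieBracket (𝓡 3) X Y p := mlieBracket_swap_apply
  rw [map_sub, form_nabla, form_nabla, koszul_frame, koszul_frame, hcomm, hswap, map_neg]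
  ring

theorem metric_apply_smooth (hX : X.IsSmooth) (hY : Y.IsSmooth) :
    IsSmoothFun (fun p => e.metric p (X p) (Y p)) := by
  simp only [metric_apply]
  exact contMDiff_finsetSum fun a _ => ContMDiff.mul ((e.smooth a).apply hX) ((e.smooth a).apply hY)

theorem koszul_add (hX : X.IsSmooth) (hY : Y.IsSmooth) (hY' : Y'.IsSmooth) (hZ : Z.IsSmooth)
    (p : M) : e.koszul X (Y + Y') Z p = e.koszul X Y Z p + e.koszul X Y' Z p := by
  have hmetric := fun {V W : VField M} (hV : V.IsSmooth) (hW : W.IsSmooth) =>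
    (e.metric_apply_smooth hV hW).mdifferentiableAt p
  have hadd : ∀ W : VField M, dirDeriv (Y + Y') (fun q => e.metric q (Z q) (W q)) p =
      dirDeriv Y (fun q => e.metric q (Z q) (W q)) p +
        dirDeriv Y' (fun q => e.metric q (Z q) (W q)) p := fun W => map_add _ _ _
  simp only [koszul, hadd, Pi.add_apply, map_add, add_apply]
  rw [dirDeriv_add _ (hmetric hY hZ) (hmetric hY' hZ),
    dirDeriv_add _ (hmetric hX hY) (hmetric hX hY'),
    mlieBracket_add_right (hY.mdifferentiableAt p) (hY'.mdifferentiableAt p),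
    mlieBracket_add_left (hY.mdifferentiableAt p) (hY'.mdifferentiableAt p)]
  simp only [map_add, add_apply]
  ring

theorem nabla_add (hX : X.IsSmooth) (hY : Y.IsSmooth) (hZ : Z.IsSmooth) (p : M) :
    e.nabla X (Y + Z) p = e.nabla X Y p + e.nabla X Z p :=
  e.ext_form fun k => by
    rw [map_add, form_nabla, form_nabla, form_nabla, e.koszul_add hX hY hZ (e.frame_smooth k),
      add_div]

theorem two_mul_form_nabla (hX : X.IsSmooth) (hY : Y.IsSmooth) (k : Fin 3) (p : M) :
    2 * e.form k p (e.nabla X Y p) =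
      2 * dirDeriv X (fun q => e.form k q (Y q)) p - extDeriv1 (e.form k) X Y p +
        ∑ j, (e.form j p (X p) * extDeriv1 (e.form j) Y (e.frame k) p +
          e.form j p (Y p) * extDeriv1 (e.form j) X (e.frame k) p) := by
  have hform := fun j {Z : VField M} (hZ : Z.IsSmooth) =>
    ((e.smooth j).apply hZ).mdifferentiableAt p
  have hmetric : dirDeriv (e.frame k) (fun q => e.metric q (X q) (Y q)) p =
      ∑ j, (e.form j p (X p) * dirDeriv (e.frame k) (fun q => e.form j q (Y q)) p +
        e.form j p (Y p) * dirDeriv (e.frame k) (fun q => e.form j q (X q)) p) := by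
    simp only [metric_apply]
    exact (dirDeriv_sum _ fun j _ => (hform j hX).mul (hform j hY)).trans
      (Finset.sum_congr rfl fun j _ => dirDeriv_mul _ (hform j hX) (hform j hY))
  rw [form_nabla, koszul_frame, hmetric]
  simp only [extDeriv1, form_frame, dirDeriv_const, metric_apply, Fin.sum_univ_three]
  ring

theorem form_nabla_frame_antisymm (hX : X.IsSmooth) (b k : Fin 3) (p : M) :
    e.form k p (e.nabla X (e.frame b) p) = -e.form b p (e.nabla X (e.frame k) p) := by
  have hb := e.two_mul_form_nabla hX (e.frame_smooth b) k p
  have hk := e.two_mul_form_nabla hX (e.frame_smooth k) b p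
  have hswap : ∀ j, extDeriv1 (e.form j) (e.frame k) (e.frame b) p =
      -extDeriv1 (e.form j) (e.frame b) (e.frame k) p := fun j => extDeriv1_swap _ _ _ _
  simp only [form_frame, dirDeriv_const, Finset.sum_add_distrib, ite_mul, one_mul, zero_mul,
    Finset.sum_ite_eq', Finset.mem_univ, if_true, hswap, mul_neg, Finset.sum_neg_distrib] at hb hk
  linarith

theorem nabla_smooth (hX : X.IsSmooth) (hY : Y.IsSmooth) : (e.nabla X Y).IsSmooth := by
  refine e.isSmooth_of_form fun k => ?_
  have hformula : (fun p => e.form k p (e.nabla X Y p)) = fun p => 2⁻¹ * _ :=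
    funext fun p => (inv_mul_cancel_left₀ two_ne_zero _).symm.trans
      (congrArg _ (e.two_mul_form_nabla hX hY k p))
  have hd := fun j {V W : VField M} (hV : V.IsSmooth) (hW : W.IsSmooth) =>
    (e.smooth j).extDeriv1 hV hW
  have hform := fun j {V : VField M} (hV : V.IsSmooth) => (e.smooth j).apply hV
  rw [hformula]
  refine contMDiff_const.mul
    (((contMDiff_const.mul ((hform k hY).dirDeriv hX)).sub (hd k hX hY)).add
      (contMDiff_finsetSum fun j _ => ?_))
  exact ((hform j hX).mul (hd j hY (e.frame_smooth k))).add
    ((hform j hY).mul (hd j hX (e.frame_smooth k)))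

theorem riemann_bianchi (hX : X.IsSmooth) (hY : Y.IsSmooth) (hZ : Z.IsSmooth) (p : M) :
    e.riemann X Y Z p + e.riemann Y Z X p + e.riemann Z X Y p = 0 := by
  have hnabla : ∀ {U V W : VField M}, U.IsSmooth → V.IsSmooth → W.IsSmooth →
      e.nabla U (e.nabla V W) p - e.nabla U (e.nabla W V) p - e.nabla (mlieBracket (𝓡 3) V W) U p =
        mlieBracket (𝓡 3) U (mlieBracket (𝓡 3) V W) p := by
    intro U V W hU hV hW
    have hVW : e.nabla V W = e.nabla W V + mlieBracket (𝓡 3) V W := funext fun q => by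
      rw [Pi.add_apply, ← e.nabla_sub_nabla_swap V W q, add_sub_cancel]
    rw [hVW, e.nabla_add hU (e.nabla_smooth hW hV) (hV.mlieBracket hW),
      ← e.nabla_sub_nabla_swap U (mlieBracket (𝓡 3) V W)]
    abel
  have hcyclic := mlieBracket_cyclic hX hY hZ p
  rw [← hnabla hX hY hZ, ← hnabla hY hZ hX, ← hnabla hZ hX hY] at hcyclic
  rw [← hcyclic]
  simp only [riemann]
  abel

end LeviCivita

/-- `A` is the matrix of connection forms of `∇` in the frame dual to `e`:
`∇_X E_b = ∑ k, A_bk(X) E_k`, stated together with the Leibniz rule for `∇`. -/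
def IsConnectionForm (A : Fin 3 → Fin 3 → OneForm M) : Prop :=
  ∀ X Y : VField M, X.IsSmooth → Y.IsSmooth → ∀ k p, e.form k p (e.nabla X Y p) =
    dirDeriv X (fun q => e.form k q (Y q)) p + ∑ j, e.form j p (Y p) * A j k p (X p)

section ConnectionForm

variable {e} {A : Fin 3 → Fin 3 → OneForm M} {X Y : VField M}

theorem IsConnectionForm.form_nabla_frame (hA : e.IsConnectionForm A) (hX : X.IsSmooth)
    (b k : Fin 3) (p : M) : e.form k p (e.nabla X (e.frame b) p) = A b k p (X p) := by
  rw [hA X _ hX (e.frame_smooth b)]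
  simp [form_frame, dirDeriv_const]

theorem IsConnectionForm.nabla_eq_sum (hA : e.IsConnectionForm A) (hX : X.IsSmooth)
    (hY : Y.IsSmooth) (p : M) :
    e.nabla X Y p = ∑ b, (dirDeriv X (fun q => e.form b q (Y q)) p • e.frame b p +
      e.form b p (Y p) • e.nabla X (e.frame b) p) :=
  e.ext_form fun k => by
    simp [hA X Y hX hY, hA.form_nabla_frame hX, form_frame, Finset.sum_add_distrib]

theorem IsConnectionForm.form_riemann_frame (hA : e.IsConnectionForm A) (hX : X.IsSmooth)
    (hY : Y.IsSmooth) (b k : Fin 3) (p : M) :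
    e.form k p (e.riemann X Y (e.frame b) p) =
      extDeriv1 (A b k) X Y p + ∑ j, wedge (A j k) (A b j) X Y p := by
  have hnabla : ∀ {U V : VField M}, U.IsSmooth → V.IsSmooth →
      e.form k p (e.nabla U (e.nabla V (e.frame b)) p) =
        dirDeriv U (fun q => A b k q (V q)) p + ∑ j, A b j p (V p) * A j k p (U p) := by
    intro U V hU hV
    rw [hA U _ hU (e.nabla_smooth hV (e.frame_smooth b))]
    simp only [hA.form_nabla_frame hV]
  simp only [riemann, map_sub]
  rw [hnabla hX hY, hnabla hY hX, hA.form_nabla_frame (hX.mlieBracket hY), extDeriv1]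
  simp only [wedge, Fin.sum_univ_three]
  ring

end ConnectionForm

section Codazzi

variable (Θ : SymTensor M) {X Y Z : VField M}

theorem contract_smooth (a : Fin 3) : (e.contract Θ a).IsSmooth :=
  ContMDiff.clm_bundle_apply (b := fun q : M => q) (E₁ := fun q : M => TangentSpace (𝓡 3) q)
    (E₂ := fun q : M => TangentSpace (𝓡 3) q →L[ℝ] Trivial M ℝ q) Θ.smooth (e.frame_smooth a)

theorem sum_form_mul_contract (p : M) (v w : TangentSpace (𝓡 3) p) :
    ∑ a, e.form a p v * e.contract Θ a p w = Θ.toFun p v w := by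
  conv_rhs => rw [← e.sum_form_smul_frame p v]
  simp [contract]

theorem sum_wedge_form_contract (X Y : VField M) (p : M) :
    ∑ a, wedge (e.form a) (e.contract Θ a) X Y p = 0 := by
  simp only [wedge, Finset.sum_sub_distrib, sum_form_mul_contract]
  rw [Θ.symm, sub_self]

theorem nablaTensor_comm (X Y Z : VField M) (p : M) :
    e.nablaTensor Θ X Y Z p = e.nablaTensor Θ X Z Y p := by
  simp only [nablaTensor, Θ.symm _ (Y _), Θ.symm _ (e.nabla X Y p)]
  ring

/-- The exterior covariant derivative `(d^∇ Θ)(X, Y; Z) = (∇_X Θ)(Y, Z) - (∇_Y Θ)(X, Z)`, whose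
vanishing is the Codazzi equation. -/
def codazzi (X Y Z : VField M) (p : M) : ℝ :=
  e.nablaTensor Θ X Y Z p - e.nablaTensor Θ Y X Z p

theorem codazzi_self (X Z : VField M) (p : M) : e.codazzi Θ X X Z p = 0 :=
  sub_self _

theorem codazzi_swap (X Y Z : VField M) (p : M) :
    e.codazzi Θ X Y Z p = -e.codazzi Θ Y X Z p := by
  simp only [codazzi, neg_sub]

theorem codazzi_cyclic (X Y Z : VField M) (p : M) :
    e.codazzi Θ X Y Z p + e.codazzi Θ Y Z X p + e.codazzi Θ Z X Y p = 0 := by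
  simp only [codazzi]
  rw [e.nablaTensor_comm Θ X Z Y, e.nablaTensor_comm Θ Y X Z, e.nablaTensor_comm Θ Z Y X]
  ring

theorem dirDeriv_tr (hX : X.IsSmooth) (p : M) :
    dirDeriv X (e.tr Θ) p = ∑ a, e.nablaTensor Θ X (e.frame a) (e.frame a) p := by
  have hzero : ∑ a, Θ.toFun p (e.nabla X (e.frame a) p) (e.frame a p) = 0 := by
    simp only [← e.sum_form_mul_contract Θ p (e.nabla X (e.frame _) p), contract]
    rw [← self_eq_neg, ← Finset.sum_neg_distrib, Finset.sum_comm]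
    refine Finset.sum_congr rfl fun b _ => ?_
    rw [← Finset.sum_neg_distrib]
    refine Finset.sum_congr rfl fun a _ => ?_
    rw [e.form_nabla_frame_antisymm hX, Θ.symm, neg_mul]
  simp only [nablaTensor, Θ.symm p (e.frame _ p) (e.nabla X (e.frame _) p), Finset.sum_sub_distrib,
    hzero, sub_zero]
  exact dirDeriv_sum _ fun a _ =>
    (Θ.smooth.apply (e.frame_smooth a) (e.frame_smooth a)).mdifferentiableAt p

theorem dirDeriv_tr_sub_div (hX : X.IsSmooth) (p : M) :
    dirDeriv X (e.tr Θ) p - e.div Θ X p = ∑ a, e.codazzi Θ X (e.frame a) (e.frame a) p := by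
  rw [dirDeriv_tr e Θ hX, div, ← Finset.sum_sub_distrib]
  simp only [codazzi, e.nablaTensor_comm Θ _ X]

variable {e} {A : Fin 3 → Fin 3 → OneForm M}

theorem IsConnectionForm.codazzi_frame (hA : e.IsConnectionForm A) (hX : X.IsSmooth)
    (hY : Y.IsSmooth) (b : Fin 3) (p : M) :
    e.codazzi Θ X Y (e.frame b) p =
      extDeriv1 (e.contract Θ b) X Y p - ∑ j, wedge (A b j) (e.contract Θ j) X Y p := by
  have hframe : ∀ {U V : VField M}, U.IsSmooth →
      Θ.toFun p (V p) (e.nabla U (e.frame b) p) =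
        ∑ j, A b j p (U p) * e.contract Θ j p (V p) := by
    intro U V hU
    rw [Θ.symm, ← e.sum_form_mul_contract]
    simp only [hA.form_nabla_frame hU]
  have hcontract : ∀ q (v : TangentSpace (𝓡 3) q),
      Θ.toFun q v (e.frame b q) = e.contract Θ b q v := fun q v => Θ.symm q _ _
  simp only [codazzi, nablaTensor, extDeriv1, wedge, hframe hX, hframe hY, hcontract,
    ← e.nabla_sub_nabla_swap X Y p, map_sub, Finset.sum_sub_distrib]
  ring

theorem IsConnectionForm.nablaTensor_eq_sum (hA : e.IsConnectionForm A) (hX : X.IsSmooth)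
    (hY : Y.IsSmooth) (hZ : Z.IsSmooth) (p : M) :
    e.nablaTensor Θ X Y Z p =
      ∑ b, e.form b p (Y p) * e.nablaTensor Θ X (e.frame b) Z p := by
  have hexpand : dirDeriv X (fun q => Θ.toFun q (Y q) (Z q)) p =
      ∑ b, (e.form b p (Y p) * dirDeriv X (fun q => Θ.toFun q (e.frame b q) (Z q)) p +
        Θ.toFun p (e.frame b p) (Z p) * dirDeriv X (fun q => e.form b q (Y q)) p) := by
    have hform := fun b => ((e.smooth b).apply hY).mdifferentiableAt p
    have hΘ := fun b => (Θ.smooth.apply (e.frame_smooth b) hZ).mdifferentiableAt p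
    simp only [← e.sum_form_mul_contract Θ _ (Y _)]
    exact (dirDeriv_sum _ fun b _ => (hform b).mul (hΘ b)).trans
      (Finset.sum_congr rfl fun b _ => dirDeriv_mul _ (hform b) (hΘ b))
  rw [nablaTensor, hexpand, hA.nabla_eq_sum hX hY, ← e.sum_form_mul_contract Θ p (Y p)]
  simp only [nablaTensor, contract, map_sum, map_add, map_smul, sum_apply, add_apply, smul_apply,
    smul_eq_mul, ← Finset.sum_sub_distrib]
  exact Finset.sum_congr rfl fun b _ => by ring

theorem IsConnectionForm.dirDeriv_tr_sub_div_eq_sum (hA : e.IsConnectionForm A)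
    (hX : X.IsSmooth) (p : M) :
    dirDeriv X (e.tr Θ) p - e.div Θ X p =
      ∑ b, e.form b p (X p) * (dirDeriv (e.frame b) (e.tr Θ) p - e.div Θ (e.frame b) p) := by
  have htr : dirDeriv X (e.tr Θ) p =
      ∑ b, e.form b p (X p) * dirDeriv (e.frame b) (e.tr Θ) p := by
    simp only [dirDeriv]
    conv_lhs => rw [← e.sum_form_smul_frame p (X p)]
    simp only [map_sum, map_smul, smul_eq_mul]
  have hdiv : e.div Θ X p = ∑ b, e.form b p (X p) * e.div Θ (e.frame b) p := by
    simp only [div, Finset.mul_sum]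
    rw [Finset.sum_comm]
    refine Finset.sum_congr rfl fun a _ => ?_
    rw [nablaTensor_comm, hA.nablaTensor_eq_sum Θ (e.frame_smooth a) hX (e.frame_smooth a)]
    exact Finset.sum_congr rfl fun b _ => by rw [nablaTensor_comm]
  simp only [htr, hdiv, mul_sub, Finset.sum_sub_distrib]

end Codazzi

end Coframe

theorem IsExact.extDeriv1_eq_zero {α : OneForm M} (hα : IsExact α) {X Y Z : VField M}
    (hX : X.IsSmooth) (hY : Y.IsSmooth) (hZ : Z.IsSmooth) {p : M} (hp : Z p ≠ 0) :
    extDeriv1 α X Y p = 0 := by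
  obtain ⟨f, hf, hαf⟩ := hα
  have happly : ∀ W : VField M, (fun q => α q (W q)) = dirDeriv W f := fun W =>
    funext fun q => by rw [hαf, dirDeriv]
  have hbracket := dirDeriv_mlieBracket hX hY hf hZ hp
  rw [extDeriv1, happly, happly, congrFun (happly (mlieBracket (𝓡 3) X Y)) p, hbracket, sub_self]

/-- A Killing Cauchy pair up to its cohomological condition: the structure equations of the coframe
in the uniform shape `de_a = Θ(e_a) ∧ e_u + λ e_a ∧ e_l` (for `a = l` the last term is zero), with
the one-form `Θ(e_u) + λ e_l` only required to be closed. -/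
structure IsClosedKillingCauchyPair (lam : ℝ) (e : Coframe M) (Θ : SymTensor M) : Prop where
  d_form : ∀ a, ∀ X Y : VField M, X.IsSmooth → Y.IsSmooth → ∀ p, extDeriv1 (e.form a) X Y p =
    wedge (e.contract Θ a) e.u X Y p + lam * wedge (e.form a) e.l X Y p
  closed : ∀ X Y : VField M, X.IsSmooth → Y.IsSmooth → ∀ p,
    extDeriv1 (e.contract Θ 0 + lam • e.l) X Y p = 0

variable {lam : ℝ} {e : Coframe M} {Θ : SymTensor M}

theorem IsKillingCauchyPair.isClosedKillingCauchyPair (h : IsKillingCauchyPair lam e Θ) :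
    IsClosedKillingCauchyPair lam e Θ where
  d_form a X Y hX hY p := by
    fin_cases a
    · exact h.d_u X Y hX hY p
    · have hl : wedge e.l e.l X Y p = 0 := by rw [wedge, mul_comm, sub_self]
      exact (h.d_l X Y hX hY p).trans (by simp only [Fin.mk_one, hl, mul_zero, add_zero])
    · exact h.d_n X Y hX hY p
  closed _ _ hX hY p := h.exact.extDeriv1_eq_zero hX hY (e.frame_smooth 0) (e.frame_ne_zero 0 p)

/-- The Levi-Civita connection forms of a Killing Cauchy pair:
`A_bk = δ_ku Θ(e_b) - δ_bu Θ(e_k) + λ (δ_kl e_b - δ_bl e_k)`. -/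
def killingConnection (lam : ℝ) (e : Coframe M) (Θ : SymTensor M) (b k : Fin 3) : OneForm M :=
  (if k = 0 then 1 else 0 : ℝ) • e.contract Θ b - (if b = 0 then 1 else 0 : ℝ) • e.contract Θ k +
    lam • ((if k = 1 then 1 else 0 : ℝ) • e.form b - (if b = 1 then 1 else 0 : ℝ) • e.form k)

theorem killingConnection_apply (b k : Fin 3) (p : M) (v : TangentSpace (𝓡 3) p) :
    killingConnection lam e Θ b k p v =
      (if k = 0 then 1 else 0) * e.contract Θ b p v -
        (if b = 0 then 1 else 0) * e.contract Θ k p v +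
      lam * ((if k = 1 then 1 else 0) * e.form b p v -
        (if b = 1 then 1 else 0) * e.form k p v) :=
  rfl

theorem extDeriv1_killingConnection (b k : Fin 3) {X Y : VField M} (hX : X.IsSmooth)
    (hY : Y.IsSmooth) (p : M) :
    extDeriv1 (killingConnection lam e Θ b k) X Y p =
      (if k = 0 then 1 else 0) * extDeriv1 (e.contract Θ b) X Y p -
        (if b = 0 then 1 else 0) * extDeriv1 (e.contract Θ k) X Y p +
      lam * ((if k = 1 then 1 else 0) * extDeriv1 (e.form b) X Y p -
        (if b = 1 then 1 else 0) * extDeriv1 (e.form k) X Y p) := by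
  have hΘ := fun (c : ℝ) a => (e.contract_smooth Θ a).smul c
  have he := fun (c : ℝ) a => (e.smooth a).smul c
  rw [killingConnection,
    extDeriv1_add ((hΘ _ b).sub (hΘ _ k)) (((he _ b).sub (he _ k)).smul lam) hX hY,
    extDeriv1_smul lam ((he _ b).sub (he _ k)) hX hY, extDeriv1_sub (hΘ _ b) (hΘ _ k) hX hY,
    extDeriv1_sub (he _ b) (he _ k) hX hY, extDeriv1_smul _ (e.contract_smooth Θ b) hX hY,
    extDeriv1_smul _ (e.contract_smooth Θ k) hX hY, extDeriv1_smul _ (e.smooth b) hX hY,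
    extDeriv1_smul _ (e.smooth k) hX hY]

namespace IsClosedKillingCauchyPair

variable (h : IsClosedKillingCauchyPair lam e Θ) {X Y : VField M}

include h

theorem sum_form_mul_extDeriv1_frame (hY : Y.IsSmooth) (k : Fin 3) (p : M) :
    ∑ j, e.form j p (X p) * extDeriv1 (e.form j) Y (e.frame k) p =
      (if k = 0 then 1 else 0) * Θ.toFun p (X p) (Y p) - e.u p (Y p) * e.contract Θ k p (X p) +
        lam * ((if k = 1 then 1 else 0) * e.metric p (X p) (Y p) -
          e.form k p (X p) * e.l p (Y p)) := by
  have hcontract : e.contract Θ k p (X p) =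
      ∑ j, e.form j p (X p) * e.contract Θ j p (e.frame k p) := by
    rw [e.sum_form_mul_contract, Θ.symm, Coframe.contract]
  rw [hcontract, ← e.sum_form_mul_contract, e.metric_apply]
  simp only [h.d_form _ _ _ hY (e.frame_smooth k), wedge, e.form_frame, Fin.sum_univ_three]
  fin_cases k <;> simp <;> ring

theorem isConnectionForm : e.IsConnectionForm (killingConnection lam e Θ) := by
  intro X Y hX hY k p
  have hkoszul := e.two_mul_form_nabla hX hY k p
  rw [Finset.sum_add_distrib, h.sum_form_mul_extDeriv1_frame hY, h.sum_form_mul_extDeriv1_frame hX,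
    h.d_form k X Y hX hY, e.metric_comm p (Y p), Θ.symm p (Y p)] at hkoszul
  have hconnection : ∑ j, e.form j p (Y p) * killingConnection lam e Θ j k p (X p) =
      (if k = 0 then 1 else 0) * Θ.toFun p (X p) (Y p) - e.u p (Y p) * e.contract Θ k p (X p) +
        lam * ((if k = 1 then 1 else 0) * e.metric p (X p) (Y p) -
          e.form k p (X p) * e.l p (Y p)) := by
    rw [Θ.symm, ← e.sum_form_mul_contract, e.metric_apply]
    simp only [killingConnection_apply, Fin.sum_univ_three, Fin.reduceEq, reduceIte]
    ring
  rw [hconnection]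
  simp only [wedge] at hkoszul
  linarith

theorem codazzi_frame (hX : X.IsSmooth) (hY : Y.IsSmooth) (b : Fin 3) (p : M) :
    e.codazzi Θ X Y (e.frame b) p =
      extDeriv1 (e.contract Θ b) X Y p - wedge (e.contract Θ b) (e.contract Θ 0) X Y p -
        lam * wedge (e.form b) (e.contract Θ 1) X Y p := by
  have hsymm := e.sum_wedge_form_contract Θ X Y p
  rw [h.isConnectionForm.codazzi_frame Θ hX hY]
  simp only [wedge, killingConnection_apply, Fin.sum_univ_three, Fin.reduceEq, reduceIte] at hsymm ⊢
  linear_combination lam * (if b = 1 then 1 else 0) * hsymm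

theorem codazzi_frame_zero (hX : X.IsSmooth) (hY : Y.IsSmooth) (p : M) :
    e.codazzi Θ X Y (e.frame 0) p = 0 := by
  have hclosed := h.closed X Y hX hY p
  rw [extDeriv1_add (e.contract_smooth Θ 0) ((e.smooth 1).smul lam) hX hY,
    extDeriv1_smul lam (e.smooth 1) hX hY, h.d_form 1 X Y hX hY] at hclosed
  rw [h.codazzi_frame hX hY]
  simp only [wedge] at hclosed ⊢
  linear_combination hclosed

theorem form_riemann_frame (hX : X.IsSmooth) (hY : Y.IsSmooth) (b k : Fin 3) (p : M) :
    e.form k p (e.riemann X Y (e.frame b) p) =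
      (if k = 0 then 1 else 0) * e.codazzi Θ X Y (e.frame b) p -
        (if b = 0 then 1 else 0) * e.codazzi Θ X Y (e.frame k) p +
      wedge (e.contract Θ b) (e.contract Θ k) X Y p +
        lam ^ 2 * wedge (e.form b) (e.form k) X Y p := by
  have hsymm := e.sum_wedge_form_contract Θ X Y p
  rw [h.isConnectionForm.form_riemann_frame hX hY, extDeriv1_killingConnection b k hX hY,
    h.codazzi_frame hX hY, h.codazzi_frame hX hY, h.d_form b X Y hX hY, h.d_form k X Y hX hY]
  simp only [wedge, killingConnection_apply, Fin.sum_univ_three, Fin.reduceEq, reduceIte] at hsymm ⊢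
  linear_combination lam * ((if k = 0 then 1 else 0) * (if b = 1 then 1 else 0) -
    (if k = 1 then 1 else 0) * (if b = 0 then 1 else 0)) * hsymm

theorem codazzi_frame_one_two (k : Fin 3) (p : M) :
    e.codazzi Θ (e.frame 1) (e.frame 2) (e.frame k) p = 0 := by
  have hbianchi := congrArg (e.form k p)
    (e.riemann_bianchi (e.frame_smooth 0) (e.frame_smooth 1) (e.frame_smooth 2) p)
  have hcyclic := e.codazzi_cyclic Θ (e.frame 0) (e.frame 1) (e.frame 2) p
  have hΘ := fun a b => Θ.symm p (e.frame a p) (e.frame b p)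
  simp only [map_add, map_zero, h.form_riemann_frame (e.frame_smooth _) (e.frame_smooth _), wedge,
    e.form_frame, Coframe.contract, hΘ 1 0, hΘ 2 0, hΘ 2 1] at hbianchi
  simp only [Fin.reduceEq, reduceIte] at hbianchi
  linear_combination (if k = 0 then 1 else 0) * hcyclic - hbianchi

theorem scal_eq (p : M) :
    e.scal p = e.normSq Θ p - e.tr Θ p ^ 2 - 6 * lam ^ 2 +
      2 * ∑ a, e.codazzi Θ (e.frame 0) (e.frame a) (e.frame a) p := by
  have hswap := fun a => e.codazzi_swap Θ (e.frame a) (e.frame 0) (e.frame a) p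
  have hΘ := fun a b => Θ.symm p (e.frame a p) (e.frame b p)
  simp only [Coframe.scal, Coframe.ricci, e.metric_frame_right, Coframe.normSq, Coframe.tr, wedge,
    Coframe.contract, e.form_frame, h.form_riemann_frame (e.frame_smooth _) (e.frame_smooth _),
    Fin.sum_univ_three, Fin.reduceEq, reduceIte, e.codazzi_self, hswap 1, hswap 2,
    hΘ 1 0, hΘ 2 0, hΘ 2 1]
  ring

theorem dirDeriv_tr_sub_div_frame_of_ne_zero {b : Fin 3} (hb : b ≠ 0) (p : M) :
    dirDeriv (e.frame b) (e.tr Θ) p - e.div Θ (e.frame b) p = 0 := by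
  have h12 := fun k => h.codazzi_frame_one_two k p
  rw [e.dirDeriv_tr_sub_div Θ (e.frame_smooth b), Fin.sum_univ_three,
    h.codazzi_frame_zero (e.frame_smooth b) (e.frame_smooth 0), zero_add]
  obtain rfl | rfl : b = 1 ∨ b = 2 := by omega
  · rw [e.codazzi_self, h12, add_zero]
  · rw [e.codazzi_self, e.codazzi_swap, h12, neg_zero, add_zero]

theorem two_mul_dirDeriv_tr_sub_div (hX : X.IsSmooth) (p : M) :
    2 * (dirDeriv X (e.tr Θ) p - e.div Θ X p) =
      (e.scal p - (e.normSq Θ p - e.tr Θ p ^ 2 + 2 * (-3 * lam ^ 2))) * e.u p (X p) := by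
  rw [h.isConnectionForm.dirDeriv_tr_sub_div_eq_sum Θ hX, Fin.sum_univ_three,
    h.dirDeriv_tr_sub_div_frame_of_ne_zero (b := 1) (by simp),
    h.dirDeriv_tr_sub_div_frame_of_ne_zero (b := 2) (by simp),
    e.dirDeriv_tr_sub_div Θ (e.frame_smooth 0), h.scal_eq]
  ring

end IsClosedKillingCauchyPair

end KillingCauchy

end

open KillingCauchy in
theorem mainTheorem9_general {M : Type*} [TopologicalSpace M] [ChartedSpace E3 M]
    [IsManifold (𝓡 3) ∞ M] {lam : ℝ} {e : Coframe M} {Θ : SymTensor M}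
    (h : IsClosedKillingCauchyPair lam e Θ) :
    HamiltonianConstraint (-3 * lam ^ 2) e Θ ↔ MomentumConstraint e Θ := by
  refine ⟨fun hham X hX p => ?_, fun hmom p => ?_⟩
  · have hdefect := h.two_mul_dirDeriv_tr_sub_div hX p
    rw [hham p, sub_self, zero_mul] at hdefect
    linarith
  · have hdefect := h.two_mul_dirDeriv_tr_sub_div (e.frame_smooth 0) p
    rw [hmom _ (e.frame_smooth 0) p, sub_self, mul_zero, e.form_frame, if_pos rfl, mul_one]
      at hdefect
    linarith

theorem mainTheorem9 {M : Type*} [TopologicalSpace M] [T2Space M] [SecondCountableTopology M]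
    [ChartedSpace (EuclideanSpace ℝ (Fin 3)) M] [IsManifold (𝓡 3) ∞ M]
    (lam : ℝ) (e : KillingCauchy.Coframe M) (Θ : KillingCauchy.SymTensor M)
    (hpair : KillingCauchy.IsKillingCauchyPair lam e Θ) :
    KillingCauchy.HamiltonianConstraint (-3 * lam ^ 2) e Θ ↔
      KillingCauchy.MomentumConstraint e Θ :=
  mainTheorem9_general hpair.isClosedKillingCauchyPair
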